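/- Let $R$ be a commutative ring, and let $\aleph_1$ be the first uncountable cardinal. Recall that an object $S$ of a category with $\aleph_1$-filtered colimits is $\aleph_1$-presentable if $\operatorname{Hom}(S,-)$ preserves $\aleph_1$-filtered colimits, and that a category is locally $\aleph_1$-presentable if it has all small colimits and there is a set of $\aleph_1$-presentable objects such that every object is an $\aleph_1$-filtered colimit of objects from this set. An $R$-module is called countably presentable if it is an $\aleph_1$-presentable object of the category of $R$-modules. Morphisms of $R$-coalgebras are the $R$-linear maps compatible with comultiplication and counit. (a) The category of coassociative, counital $R$-coalgebras is locally $\aleph_1$-presentable. Its $\aleph_1$-presentable objects are precisely the $R$-coalgebras whose underlying $R$-module is countably presentable. (b) The category of coassociative, cocommutative, counital $R$-coalgebras (a full subcategory of the category in (a)) is locally $\aleph_1$-presentable. Its $\aleph_1$-presentable objects are precisely the cocommutative $R$-coalgebras whose underlying $R$-module is countably presentable. -/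

import Mathlib

open CategoryTheory
open scoped Cardinal

universe u

/-- The regularity of `ℵ₁`, available to instance search. -/
instance fact_isRegular_aleph_one : Fact (ℵ₁ : Cardinal.{u}).IsRegular :=
  ⟨Cardinal.isRegular_aleph_one⟩

/-- The property of an `R`-coalgebra of being cocommutative. -/
def isCocommCoalg (R : Type u) [CommRing R] : ObjectProperty (CoalgCat.{u} R) :=
  fun C => Coalgebra.IsCocomm R C

/-- The category of coassociative, counital, cocommutative `R`-coalgebras: the full subcategory of
the category of `R`-coalgebras on the cocommutative ones. -/
abbrev CocommCoalgCat (R : Type u) [CommRing R] : Type (u + 1) :=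
  (isCocommCoalg R).FullSubcategory

/-! The heart is that every coalgebra C is an ℵ₁-filtered colimit of coalgebras with countably
presented underlying module. Let F be the free module on the set C, and lift the comultiplication
arbitrarily to F → F ⊗ F (`comulLift`). A set A of generators and relations of C presents a module
`PartialModule A`, a quotient of F, so this single lift serves for all A. The coalgebra axioms may
fail for the lift, but each failure at a given generator is an element of a tensor product that dies
over C. By right exactness of ⊗ only finitely many relations are needed to kill it
(`eventually_map_eq_zero`, `eventually_good`). Closing a countable set under these finite demands
gives a countable admissible set, whose module is a coalgebra over C. Admissible sets are stable
under countable unions, so the countable ones form an ℵ₁-directed poset, and C is the colimit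
(`isColimitCocone`).

Conversely, a coalgebra is ℵ₁-presentable if its module is (`isCardinalPresentable_of_forget`):
colimits of coalgebras are computed on modules, and tensor squares commute with filtered colimits.
Hence the coalgebras above form a generator, and every ℵ₁-presentable coalgebra is a retract of one
of them; the forgetful functor preserves retracts. Cocommutativity is one more finite demand and is
stable under colimits, so (b) follows by the same diagram. -/

section

open TensorProduct

/-! ### Eventual vanishing in tensor products -/

section Eventually

variable {R : Type*} [CommRing R] {ι : Type*} {l : Filter ι}
  {F F' C C' : Type*} [AddCommGroup F] [AddCommGroup F'] [AddCommGroup C] [AddCommGroup C']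
  [Module R F] [Module R F'] [Module R C] [Module R C']
  {M M' : ι → Type*} [∀ i, AddCommGroup (M i)] [∀ i, AddCommGroup (M' i)]
  [∀ i, Module R (M i)] [∀ i, Module R (M' i)]

/-- If elements of the kernels of the surjections `π` and `π'` are eventually killed by `q i` and
`q' i`, then elements of the kernel of `π ⊗ π'` are eventually killed by `q i ⊗ q' i`. -/
lemma TensorProduct.eventually_map_eq_zero {π : F →ₗ[R] C} {π' : F' →ₗ[R] C'}
    (hπ : Function.Surjective π) (hπ' : Function.Surjective π')
    {q : ∀ i, F →ₗ[R] M i} {q' : ∀ i, F' →ₗ[R] M' i}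
    (h : ∀ x, π x = 0 → ∀ᶠ i in l, q i x = 0) (h' : ∀ x, π' x = 0 → ∀ᶠ i in l, q' i x = 0)
    (z : F ⊗[R] F') (hz : map π π' z = 0) :
    ∀ᶠ i in l, map (q i) (q' i) z = 0 := by
  -- Right exactness: the kernel is spanned by pure tensors with one factor in `ker π` or `ker π'`,
  -- so z involves only finitely many elements of these kernels.
  have key : LinearMap.ker (map π π') =
      LinearMap.range (LinearMap.lTensor F (LinearMap.ker π').subtype) ⊔
        LinearMap.range (LinearMap.rTensor F' (LinearMap.ker π).subtype) :=
    TensorProduct.map_ker (LinearMap.exact_subtype_ker_map π) hπ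
      (LinearMap.exact_subtype_ker_map π') hπ'
  have hz' : z ∈ LinearMap.ker (map π π') := hz
  rw [key, Submodule.mem_sup] at hz'
  obtain ⟨_, ⟨a, rfl⟩, _, ⟨b, rfl⟩, rfl⟩ := hz'
  have ha : ∀ᶠ i in l, map (q i) (q' i) (LinearMap.lTensor F (LinearMap.ker π').subtype a) = 0 := by
    clear hz
    induction a with
    | zero => simp
    | add a b ha hb => filter_upwards [ha, hb] with i h1 h2 using by simp [h1, h2]
    | tmul x y => filter_upwards [h' y y.2] with i h1 using by simp [h1]
  have hb : ∀ᶠ i in l, map (q i) (q' i) (LinearMap.rTensor F' (LinearMap.ker π).subtype b) = 0 := by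
    clear hz
    induction b with
    | zero => simp
    | add a b ha hb => filter_upwards [ha, hb] with i h1 h2 using by simp [h1, h2]
    | tmul x y => filter_upwards [h x x.2] with i h1 using by simp [h1]
  filter_upwards [ha, hb] with i h1 h2 using by rw [map_add, h1, h2, add_zero]

lemma TensorProduct.eventually_map_eq_self {ρ : ι → F →ₗ[R] F} {ρ' : ι → F' →ₗ[R] F'}
    (h : ∀ x, ∀ᶠ i in l, ρ i x = x) (h' : ∀ x, ∀ᶠ i in l, ρ' i x = x) (z : F ⊗[R] F') :
    ∀ᶠ i in l, map (ρ i) (ρ' i) z = z := by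
  induction z with
  | zero => simp
  | add a b ha hb => filter_upwards [ha, hb] with i h1 h2 using by simp [h1, h2]
  | tmul x y => filter_upwards [h x, h' y] with i h1 h2 using by simp [h1, h2]

end Eventually

/-! ### Finite demands on a set and countable closures -/

section SupersetFilter

/-- The filter of the sets containing all the elements of some large enough finite set. -/
def finsetSupersets (α : Type*) : Filter (Set α) :=
  ⨅ E : Finset α, Filter.principal {A | (E : Set α) ⊆ A}

lemma eventually_finsetSupersets {α : Type*} {p : Set α → Prop} :
    (∀ᶠ A in finsetSupersets α, p A) ↔ ∃ E : Finset α, ∀ A, (E : Set α) ⊆ A → p A := by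
  classical
  have hd : Directed (· ⊇ ·) fun E : Finset α => {A : Set α | (E : Set α) ⊆ A} := by
    refine fun E E' => ⟨E ∪ E', fun A h => ?_, fun A h => ?_⟩
    · exact Set.Subset.trans (by simp) (show ((E ∪ E' : Finset α) : Set α) ⊆ A from h)
    · exact Set.Subset.trans (by simp) (show ((E ∪ E' : Finset α) : Set α) ⊆ A from h)
  rw [finsetSupersets, (Filter.hasBasis_iInf_principal hd).eventually_iff]
  simp

lemma eventually_mem_finsetSupersets {α : Type*} (x : α) : ∀ᶠ A in finsetSupersets α, x ∈ A :=
  eventually_finsetSupersets.2 ⟨{x}, fun A h => by simpa using h⟩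

/-- A countable set is contained in a countable set that contains `E x` with any element `x`. -/
lemma exists_countable_closed_superset {α : Type*} (E : α → Finset α) {A : Set α}
    (hA : A.Countable) :
    ∃ B, A ⊆ B ∧ B.Countable ∧ ∀ x ∈ B, (E x : Set α) ⊆ B := by
  -- `next S` need not contain S. The union of all stages still works: it contains A as stage 0, and
  -- `E x` one stage after x.
  let next (S : Set α) : Set α := ⋃ x ∈ S, (E x : Set α)
  have hn (n : ℕ) : (next^[n] A).Countable := by
    induction n with
    | zero => exact hA
    | succ n ih =>
      rw [Function.iterate_succ_apply']
      exact ih.biUnion fun x _ => (E x).countable_toSet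
  refine ⟨⋃ n, next^[n] A, Set.subset_iUnion (fun n => next^[n] A) 0, Set.countable_iUnion hn,
    fun x hx => ?_⟩
  obtain ⟨n, hx⟩ := Set.mem_iUnion.1 hx
  refine Set.Subset.trans ?_ (Set.subset_iUnion (fun n => next^[n] A) (n + 1))
  rw [Function.iterate_succ_apply']
  exact Set.subset_biUnion_of_mem (u := fun x => (E x : Set α)) hx

end SupersetFilter

/-! ### Modules presented by some of the generators and relations of C -/

namespace PartialPresentation

/-- The free `R`-module on the elements of `C`. -/
def FreeOn (R C : Type*) [CommRing R] : Type _ := C →₀ R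

namespace FreeOn

variable {R C : Type*} [CommRing R] {M : Type*} [AddCommGroup M] [Module R M]

noncomputable instance : AddCommGroup (FreeOn R C) := inferInstanceAs (AddCommGroup (C →₀ R))

noncomputable instance : Module R (FreeOn R C) := inferInstanceAs (Module R (C →₀ R))

variable (R) in
/-- The basis elements of the free module. -/
noncomputable def gen (c : C) : FreeOn R C := (Finsupp.single c 1 : C →₀ R)

/-- The linear map given on the basis. -/
noncomputable def desc (f : C → M) : FreeOn R C →ₗ[R] M :=
  (Finsupp.linearCombination R f : (C →₀ R) →ₗ[R] M)

@[simp]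
lemma desc_gen (f : C → M) (c : C) : desc f (gen R c) = f c :=
  (Finsupp.linearCombination_single R 1 c).trans (one_smul R _)

lemma hom_ext {f g : FreeOn R C →ₗ[R] M} (h : ∀ c, f (gen R c) = g (gen R c)) : f = g :=
  Finsupp.lhom_ext' (M := R) fun c => LinearMap.ext_ring (h c)

@[elab_as_elim]
lemma induction {p : FreeOn R C → Prop} (x : FreeOn R C) (zero : p 0)
    (add : ∀ x y, p x → p y → p (x + y)) (smul : ∀ (r : R) x, p x → p (r • x))
    (gen : ∀ c, p (FreeOn.gen R c)) : p x :=
  Finsupp.induction_linear (M := R) x zero add fun c r => by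
    have h : (Finsupp.single c r : C →₀ R) = r • (Finsupp.single c 1 : C →₀ R) := by simp
    rw [h]
    exact smul r _ (gen c)

end FreeOn

open FreeOn

variable {R : Type*} [CommRing R] {C : Type*} [AddCommGroup C] [Module R C]

variable (R C) in
/-- Generators of an `R`-module `C` (all of its elements) and candidates for the relations. -/
abbrev Index : Type _ := C ⊕ FreeOn R C

variable (R C) in
/-- The surjection onto `C` from the free module on the elements of `C`. -/
noncomputable def total : FreeOn R C →ₗ[R] C := desc id

@[simp]
lemma total_gen (c : C) : total R C (gen R c) = c := desc_gen id c

lemma total_surjective : Function.Surjective (total R C) := fun c => ⟨gen R c, total_gen c⟩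

open scoped Classical in
/-- The projection of the free module on `C` onto the span of the generators in `A`. -/
noncomputable def restr (A : Set (Index R C)) : FreeOn R C →ₗ[R] FreeOn R C :=
  desc fun c => if Sum.inl c ∈ A then gen R c else 0

variable {A B : Set (Index R C)}

lemma restr_gen_of_mem {c : C} (hc : Sum.inl c ∈ A) : restr A (gen R c) = gen R c := by
  rw [restr, desc_gen, if_pos hc]

lemma restr_gen_of_notMem {c : C} (hc : Sum.inl c ∉ A) : restr A (gen R c) = 0 := by
  rw [restr, desc_gen, if_neg hc]

lemma restr_comp_restr (h : A ⊆ B) : restr B ∘ₗ restr A = restr A := by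
  refine FreeOn.hom_ext fun c => ?_
  by_cases hc : Sum.inl c ∈ A
  · simp [restr_gen_of_mem, hc, h hc]
  · simp [restr_gen_of_notMem, hc]

@[simp]
lemma restr_restr (x : FreeOn R C) : restr A (restr A x) = restr A x :=
  LinearMap.congr_fun (restr_comp_restr subset_rfl) x

lemma restr_of_restr (h : A ⊆ B) {x : FreeOn R C} (hx : restr A x = x) : restr B x = x := by
  rw [← hx]
  exact LinearMap.congr_fun (restr_comp_restr h) x

lemma eventually_restr_eq (x : FreeOn R C) :
    ∀ᶠ A in finsetSupersets (Index R C), restr A x = x := by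
  induction x using FreeOn.induction with
  | zero => simp
  | add a b ha hb => filter_upwards [ha, hb] with i h1 h2 using by rw [map_add, h1, h2]
  | smul r a ha => filter_upwards [ha] with i h1 using by rw [map_smul, h1]
  | gen c =>
    filter_upwards [eventually_mem_finsetSupersets (Sum.inl c)] with A hA
    exact restr_gen_of_mem hA

/-- The relations between generators in `A` that belong to `A`. -/
def relations (A : Set (Index R C)) : Set (FreeOn R C) :=
  {t | Sum.inr t ∈ A ∧ total R C t = 0 ∧ restr A t = t}

lemma relations_mono (h : A ⊆ B) : relations A ⊆ relations B :=
  fun _ ht => ⟨h ht.1, ht.2.1, restr_of_restr h ht.2.2⟩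

/-- The submodule of the free module on `C` by which one divides to get `PartialModule A`. -/
noncomputable def kernel (A : Set (Index R C)) : Submodule R (FreeOn R C) :=
  (Submodule.span R (relations A)).comap (restr A)

lemma kernel_le_iff {M : Type*} [AddCommGroup M] [Module R M] (f : FreeOn R C →ₗ[R] M)
    (hf : ∀ t ∈ relations A, f t = 0) : kernel A ≤ LinearMap.ker (f ∘ₗ restr A) := by
  have h : Submodule.span R (relations A) ≤ LinearMap.ker f := Submodule.span_le.2 hf
  exact fun x hx => h hx

/-- The module presented by the generators and relations in `A`. -/
abbrev PartialModule (A : Set (Index R C)) : Type _ := (FreeOn R C) ⧸ kernel A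

/-- The projection onto the module presented by the generators and relations in `A`, which kills
the generators outside `A`. -/
noncomputable abbrev proj (A : Set (Index R C)) : FreeOn R C →ₗ[R] PartialModule A := (kernel A).mkQ

lemma proj_eq_zero_iff {x : (FreeOn R C)} :
    proj A x = 0 ↔ restr A x ∈ Submodule.span R (relations A) := by
  rw [Submodule.mkQ_apply, Submodule.Quotient.mk_eq_zero, kernel, Submodule.mem_comap]

lemma proj_restr (x : FreeOn R C) : proj A (restr A x) = proj A x := by
  rw [← sub_eq_zero, ← map_sub, proj_eq_zero_iff]
  simp

lemma proj_comp_restr : proj A ∘ₗ restr A = proj A := LinearMap.ext proj_restr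

/-- The element x is itself a candidate relation: it counts as one as soon as A contains it and the
generators that occur in it. -/
lemma eventually_proj_eq_zero (x : FreeOn R C) (hx : total R C x = 0) :
    ∀ᶠ A in finsetSupersets (Index R C), proj A x = 0 := by
  filter_upwards [eventually_restr_eq x, eventually_mem_finsetSupersets (Sum.inr x)] with A h1 h2
  rw [proj_eq_zero_iff, h1]
  exact Submodule.subset_span ⟨h2, hx, h1⟩

/-- A linear map given on generators that respects the relations. -/
noncomputable def lift {M : Type*} [AddCommGroup M] [Module R M] (f : FreeOn R C →ₗ[R] M)
    (hf : ∀ t ∈ relations A, f t = 0) : PartialModule A →ₗ[R] M :=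
  (kernel A).liftQ (f ∘ₗ restr A) (kernel_le_iff f hf)

section

variable {M : Type*} [AddCommGroup M] [Module R M] (f : FreeOn R C →ₗ[R] M)
    (hf : ∀ t ∈ relations A, f t = 0)

@[simp]
lemma lift_proj (x : FreeOn R C) : lift f hf (proj A x) = f (restr A x) := rfl

end

lemma hom_ext {M : Type*} [AddCommGroup M] [Module R M] {f g : PartialModule A →ₗ[R] M}
    (h : ∀ c, Sum.inl c ∈ A → f (proj A (gen R c)) = g (proj A (gen R c))) :
    f = g := by
  refine Submodule.linearMap_qext _ ?_
  refine FreeOn.hom_ext fun c => ?_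
  by_cases hc : Sum.inl c ∈ A
  · exact h c hc
  · have : proj A (gen R c) = 0 := by
      rw [← proj_restr, restr_gen_of_notMem hc, map_zero]
    rw [LinearMap.comp_apply, LinearMap.comp_apply, show (kernel A).mkQ (gen R c) = 0 from this, map_zero, map_zero]

/-- The canonical map to `C` from the module presented by the generators and relations in `A`. -/
noncomputable def toModule (A : Set (Index R C)) : PartialModule A →ₗ[R] C :=
  lift (total R C) fun _ ht => ht.2.1

lemma toModule_comp_proj : toModule A ∘ₗ proj A = total R C ∘ₗ restr A := rfl

lemma toModule_proj_gen {c : C} (hc : Sum.inl c ∈ A) :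
    toModule A (proj A (gen R c)) = c := by
  rw [toModule, lift_proj, restr_gen_of_mem hc, total_gen]

/-- The transition maps between the modules presented by generators and relations. -/
noncomputable def transition (h : A ⊆ B) : PartialModule A →ₗ[R] PartialModule B :=
  lift (proj B) fun t ht => by
    have ht' := relations_mono h ht
    rw [proj_eq_zero_iff, ht'.2.2]
    exact Submodule.subset_span ht'

lemma transition_comp_proj (h : A ⊆ B) : transition h ∘ₗ proj A = proj B ∘ₗ restr A := rfl

lemma transition_proj_gen (h : A ⊆ B) {c : C} (hc : Sum.inl c ∈ A) :
    transition h (proj A (gen R c)) = proj B (gen R c) := by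
  rw [transition, lift_proj, restr_gen_of_mem hc]

lemma toModule_transition (h : A ⊆ B) (x : PartialModule A) :
    toModule B (transition h x) = toModule A x := by
  refine LinearMap.congr_fun (f := toModule B ∘ₗ transition h) (hom_ext fun c hc => ?_) x
  rw [LinearMap.comp_apply, transition_proj_gen h hc, toModule_proj_gen hc,
    toModule_proj_gen (h hc)]

lemma transition_transition {D : Set (Index R C)} (h : A ⊆ B) (h' : B ⊆ D)
    (x : PartialModule A) : transition h' (transition h x) = transition (h.trans h') x := by
  refine LinearMap.congr_fun (f := transition h' ∘ₗ transition h) (hom_ext fun c hc => ?_) x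
  rw [LinearMap.comp_apply, transition_proj_gen h hc, transition_proj_gen _ hc,
    transition_proj_gen h' (h hc)]

lemma transition_refl (x : PartialModule A) : transition subset_rfl x = x := by
  refine LinearMap.congr_fun (g := LinearMap.id) (hom_ext fun c hc => ?_) x
  rw [transition_proj_gen _ hc, LinearMap.id_apply]

/-- An element of a module presented by generators and relations that dies in `C` is killed by any
transition map to a set containing suitable relations. -/
lemma exists_transition_eq_zero {x : PartialModule A} (hx : toModule A x = 0) :
    ∃ t : FreeOn R C, ∀ (B : Set (Index R C)) (h : A ⊆ B), Sum.inr t ∈ B → transition h x = 0 := by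
  obtain ⟨x, rfl⟩ := (kernel A).mkQ_surjective x
  -- The representative `restr A x` uses only generators in A, hence in B, so it is a relation of B
  -- once B contains it.
  refine ⟨restr A x, fun B h hB => ?_⟩
  change proj B (restr A x) = 0
  have hr : restr B (restr A x) = restr A x := restr_of_restr h (restr_restr x)
  rw [proj_eq_zero_iff, hr]
  exact Submodule.subset_span ⟨hB, hx, hr⟩

/-- A presentation by the generators in `A`. -/
lemma exists_presentation (A : Set (Index R C)) :
    ∃ g : ({c : C | Sum.inl c ∈ A} →₀ R) →ₗ[R] PartialModule A, Function.Surjective g ∧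
      ∃ e : ({c : C | Sum.inl c ∈ A} →₀ R) → (FreeOn R C), Function.Injective e ∧
        LinearMap.ker g = Submodule.span R (e ⁻¹' relations A) := by
  let e : ({c : C | Sum.inl c ∈ A} →₀ R) →ₗ[R] FreeOn R C :=
    (Finsupp.lmapDomain R R Subtype.val : ({c : C | Sum.inl c ∈ A} →₀ R) →ₗ[R] (C →₀ R))
  have he : Function.Injective e := Finsupp.mapDomain_injective Subtype.val_injective
  have hgen (c : {c : C | Sum.inl c ∈ A}) : e (Finsupp.single c 1) = gen R c.1 :=
    Finsupp.mapDomain_single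
  have hre (x) : restr A (e x) = e x := by
    refine LinearMap.congr_fun (f := restr A ∘ₗ e) ?_ x
    ext c : 2
    simp only [LinearMap.comp_apply, Finsupp.lsingle_apply, hgen]
    exact restr_gen_of_mem c.2
  have hrange (x) : ∃ y, e y = restr A x := by
    change restr A x ∈ LinearMap.range e
    induction x using FreeOn.induction with
    | zero => simp
    | add a b ha hb => rw [map_add]; exact add_mem ha hb
    | smul r a ha => rw [map_smul]; exact Submodule.smul_mem _ r ha
    | gen c =>
      by_cases hc : Sum.inl c ∈ A
      · exact ⟨Finsupp.single ⟨c, hc⟩ 1, by rw [hgen, restr_gen_of_mem hc]⟩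
      · exact ⟨0, by simp [restr_gen_of_notMem hc]⟩
  refine ⟨proj A ∘ₗ e, fun y => ?_, e, he, ?_⟩
  · obtain ⟨x, rfl⟩ := (kernel A).mkQ_surjective y
    obtain ⟨y, hy⟩ := hrange x
    exact ⟨y, by rw [LinearMap.comp_apply, hy, proj_restr]⟩
  · have hsub : relations A ⊆ Set.range e := fun t ht => by
      obtain ⟨y, hy⟩ := hrange t
      exact ⟨y, hy.trans ht.2.2⟩
    have h1 : Submodule.span R (relations A) =
        (Submodule.span R (e ⁻¹' relations A)).map e := by
      rw [Submodule.map_span, Set.image_preimage_eq_of_subset hsub]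
    ext x
    rw [LinearMap.mem_ker, LinearMap.comp_apply, proj_eq_zero_iff, hre, h1]
    exact ⟨fun ⟨y, hy, hxy⟩ => he hxy ▸ hy, fun hx => ⟨x, hx, rfl⟩⟩

lemma countable_relations (hA : A.Countable) : (relations A).Countable :=
  (hA.preimage Sum.inr_injective).mono fun _ ht => ht.1

end PartialPresentation

end

/-! ### Coalgebra structures on partial presentations -/

section

open TensorProduct

namespace PartialPresentation

open FreeOn

variable {R : Type*} [CommRing R] {C : Type*} [AddCommGroup C] [Module R C] [Coalgebra R C]

variable (R C) in
/-- A lift of the comultiplication of `C` to the free module on `C`. -/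
noncomputable def comulLift : FreeOn R C →ₗ[R] (FreeOn R C) ⊗[R] (FreeOn R C) :=
  desc fun c =>
    (TensorProduct.map_surjective total_surjective total_surjective
      (Coalgebra.comul (R := R) c)).choose

lemma map_total_comulLift (x : FreeOn R C) :
    map (total R C) (total R C) (comulLift R C x) = Coalgebra.comul (total R C x) := by
  refine LinearMap.congr_fun (f := map (total R C) (total R C) ∘ₗ comulLift R C)
    (g := Coalgebra.comul ∘ₗ total R C) ?_ x
  refine FreeOn.hom_ext fun c => ?_
  rw [LinearMap.comp_apply, LinearMap.comp_apply, total_gen, comulLift, desc_gen]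
  exact (TensorProduct.map_surjective total_surjective total_surjective
      (Coalgebra.comul (R := R) c)).choose_spec

variable (R C) in
/-- The lift of the counit of `C` to the free module on `C`. -/
noncomputable def counitLift : FreeOn R C →ₗ[R] R := Coalgebra.counit ∘ₗ total R C

variable (R C) in
/-- The failure of `comulLift` to be coassociative. -/
noncomputable def coassocDefect : FreeOn R C →ₗ[R] (FreeOn R C) ⊗[R] ((FreeOn R C) ⊗[R] (FreeOn R C)) :=
  (TensorProduct.assoc R (FreeOn R C) (FreeOn R C) (FreeOn R C)).toLinearMap ∘ₗ
    (comulLift R C).rTensor (FreeOn R C) ∘ₗ comulLift R C - (comulLift R C).lTensor (FreeOn R C) ∘ₗ comulLift R C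

variable (R C) in
/-- The failure of `comulLift` to be counital on the left. -/
noncomputable def leftCounitDefect : FreeOn R C →ₗ[R] R ⊗[R] (FreeOn R C) :=
  (counitLift R C).rTensor (FreeOn R C) ∘ₗ comulLift R C - TensorProduct.mk R R (FreeOn R C) 1

variable (R C) in
/-- The failure of `comulLift` to be counital on the right. -/
noncomputable def rightCounitDefect : FreeOn R C →ₗ[R] (FreeOn R C) ⊗[R] R :=
  (counitLift R C).lTensor (FreeOn R C) ∘ₗ comulLift R C - (TensorProduct.mk R (FreeOn R C) R).flip 1

variable (R C) in
/-- The failure of `comulLift` to be cocommutative. -/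
noncomputable def commDefect : FreeOn R C →ₗ[R] (FreeOn R C) ⊗[R] (FreeOn R C) :=
  (TensorProduct.comm R (FreeOn R C) (FreeOn R C)).toLinearMap ∘ₗ comulLift R C - comulLift R C

/-- Since `total` intertwines the lift with the comultiplication of C, it carries the defect to the
corresponding defect of C, which vanishes. The other defects are treated in the same way. -/
lemma map_coassocDefect (x : FreeOn R C) :
    map (total R C) (map (total R C) (total R C)) (coassocDefect R C x) = 0 := by
  have h : map (total R C) (total R C) ∘ₗ comulLift R C = Coalgebra.comul ∘ₗ total R C :=
    LinearMap.ext map_total_comulLift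
  have h1 (z : (FreeOn R C) ⊗[R] (FreeOn R C)) :
      map (total R C) (map (total R C) (total R C)) ((comulLift R C).lTensor _ z) =
        Coalgebra.comul.lTensor C (map (total R C) (total R C) z) := by
    rw [LinearMap.lTensor, LinearMap.lTensor, TensorProduct.map_map, TensorProduct.map_map, h]
    rfl
  have h2 (z : (FreeOn R C) ⊗[R] (FreeOn R C)) :
      map (total R C) (map (total R C) (total R C))
        (TensorProduct.assoc R _ _ _ ((comulLift R C).rTensor _ z)) =
        TensorProduct.assoc R _ _ _
          (Coalgebra.comul.rTensor C (map (total R C) (total R C) z)) := by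
    rw [TensorProduct.map_map_assoc, LinearMap.rTensor, LinearMap.rTensor, TensorProduct.map_map,
      TensorProduct.map_map, h]
    rfl
  simp only [coassocDefect, LinearMap.sub_apply, LinearMap.comp_apply, map_sub, h1,
    LinearEquiv.coe_coe, h2, map_total_comulLift, Coalgebra.coassoc_apply, sub_self]

lemma map_leftCounitDefect (x : FreeOn R C) :
    map LinearMap.id (total R C) (leftCounitDefect R C x) = 0 := by
  have h1 (z : (FreeOn R C) ⊗[R] (FreeOn R C)) :
      map LinearMap.id (total R C) ((counitLift R C).rTensor _ z) =
        Coalgebra.counit.rTensor C (map (total R C) (total R C) z) := by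
    rw [LinearMap.rTensor, LinearMap.rTensor, TensorProduct.map_map, TensorProduct.map_map]
    rfl
  simp only [leftCounitDefect, LinearMap.sub_apply, LinearMap.comp_apply, map_sub, h1,
    map_total_comulLift, Coalgebra.rTensor_counit_comul, TensorProduct.mk_apply,
    TensorProduct.map_tmul, LinearMap.id_apply, sub_self]

lemma map_rightCounitDefect (x : FreeOn R C) :
    map (total R C) LinearMap.id (rightCounitDefect R C x) = 0 := by
  have h1 (z : (FreeOn R C) ⊗[R] (FreeOn R C)) :
      map (total R C) LinearMap.id ((counitLift R C).lTensor _ z) =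
        Coalgebra.counit.lTensor C (map (total R C) (total R C) z) := by
    rw [LinearMap.lTensor, LinearMap.lTensor, TensorProduct.map_map, TensorProduct.map_map]
    rfl
  simp only [rightCounitDefect, LinearMap.sub_apply, LinearMap.comp_apply, map_sub, h1,
    map_total_comulLift, Coalgebra.lTensor_counit_comul, TensorProduct.mk_apply,
    LinearMap.flip_apply, TensorProduct.map_tmul, LinearMap.id_apply, sub_self]

lemma map_commDefect [Coalgebra.IsCocomm R C] (x : FreeOn R C) :
    map (total R C) (total R C) (commDefect R C x) = 0 := by
  simp only [commDefect, LinearMap.sub_apply, LinearMap.comp_apply, map_sub, LinearEquiv.coe_coe,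
    TensorProduct.map_comm, map_total_comulLift, Coalgebra.comm_comul, sub_self]

/-- The conditions at an element of `A` that allow one to define a coalgebra structure on
`PartialModule A`. -/
def Good (A : Set (Index R C)) : Index R C → Prop
  | Sum.inl c =>
    -- The lifted comultiplication of c involves only generators in A.
    map (restr A) (restr A) (comulLift R C (gen R c)) =
        comulLift R C (gen R c) ∧
      map (proj A) (map (proj A) (proj A)) (coassocDefect R C (gen R c)) = 0 ∧
      map LinearMap.id (proj A) (leftCounitDefect R C (gen R c)) = 0 ∧
      map (proj A) LinearMap.id (rightCounitDefect R C (gen R c)) = 0 ∧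
      -- As this clause is conditional, one notion of admissibility serves both (a) and (b).
      (Coalgebra.IsCocomm R C →
        map (proj A) (proj A) (commDefect R C (gen R c)) = 0)
  -- This makes the comultiplication descend to the quotient by the relations.
  | Sum.inr t => total R C t = 0 → map (proj A) (proj A) (comulLift R C t) = 0

lemma eventually_map_proj_eq_zero (z : (FreeOn R C) ⊗[R] (FreeOn R C))
    (hz : map (total R C) (total R C) z = 0) :
    ∀ᶠ A in finsetSupersets (Index R C), map (proj A) (proj A) z = 0 :=
  eventually_map_eq_zero (q := fun A : Set (Index R C) => proj A)
    (q' := fun A : Set (Index R C) => proj A) total_surjective total_surjective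
    eventually_proj_eq_zero eventually_proj_eq_zero z hz

/-- Each clause concerns a single element of a tensor product, which either has to be fixed by
restriction or, dying over C, has to die over A. Both happen once A contains a suitable finite set.
-/
lemma eventually_good (x : Index R C) : ∀ᶠ A in finsetSupersets (Index R C), Good A x := by
  obtain c | t := x
  · have h5 : ∀ᶠ A in finsetSupersets (Index R C), Coalgebra.IsCocomm R C →
        map (proj A) (proj A) (commDefect R C (gen R c)) = 0 := by
      by_cases hC : Coalgebra.IsCocomm R C
      · filter_upwards [eventually_map_proj_eq_zero _ (map_commDefect (gen R c))]
          with A hA _ using hA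
      · simp [hC]
    have hR (x : R) (hx : LinearMap.id (R := R) x = 0) :
        ∀ᶠ A in finsetSupersets (Index R C), LinearMap.id (R := R) x = 0 :=
      Filter.Eventually.of_forall fun _ => hx
    have h1 := eventually_map_eq_self (ρ := fun A : Set (Index R C) => restr A)
      (ρ' := fun A : Set (Index R C) => restr A) eventually_restr_eq eventually_restr_eq
      (comulLift R C (gen R c))
    -- The triple tensor product is read as F ⊗ (F ⊗ F), with the two-factor case supplying the
    -- hypothesis on the second factor.
    have h2 := eventually_map_eq_zero (q := fun A : Set (Index R C) => proj A)
      (q' := fun A : Set (Index R C) => map (proj A) (proj A)) total_surjective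
      (TensorProduct.map_surjective total_surjective total_surjective)
      eventually_proj_eq_zero eventually_map_proj_eq_zero _
      (map_coassocDefect (R := R) (gen R c))
    have h3 := eventually_map_eq_zero (q := fun _ : Set (Index R C) => LinearMap.id)
      (q' := fun A : Set (Index R C) => proj A) Function.surjective_id total_surjective
      hR eventually_proj_eq_zero _ (map_leftCounitDefect (R := R) (gen R c))
    have h4 := eventually_map_eq_zero (q := fun A : Set (Index R C) => proj A)
      (q' := fun _ : Set (Index R C) => LinearMap.id) total_surjective Function.surjective_id
      eventually_proj_eq_zero hR _ (map_rightCounitDefect (R := R) (gen R c))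
    filter_upwards [h1, h2, h3, h4, h5] with A h1 h2 h3 h4 h5
    exact ⟨h1, h2, h3, h4, h5⟩
  · by_cases ht : total R C t = 0
    · filter_upwards [eventually_map_proj_eq_zero (comulLift R C t)
        (by rw [map_total_comulLift, ht, map_zero])] with A hA _ using hA
    · simp [Good, ht]

/-- A finite set of generators and relations that ensure the condition `Good` at `x`. -/
noncomputable def bound (x : Index R C) : Finset (Index R C) :=
  (eventually_finsetSupersets.1 (eventually_good x)).choose

lemma good_of_bound_subset {x : Index R C} {A : Set (Index R C)}
    (h : (bound x : Set (Index R C)) ⊆ A) : Good A x :=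
  (eventually_finsetSupersets.1 (eventually_good x)).choose_spec A h

/-- The condition on a set of generators and relations under which the module they present is a
coalgebra. -/
def IsAdmissible (A : Set (Index R C)) : Prop := ∀ x ∈ A, (bound x : Set (Index R C)) ⊆ A

namespace IsAdmissible

variable {A B : Set (Index R C)} (hA : IsAdmissible A) (hB : IsAdmissible B)

include hA in
lemma good {x : Index R C} (hx : x ∈ A) : Good A x := good_of_bound_subset (hA x hx)

/-- The comultiplication on the module presented by an admissible set. -/
noncomputable def comul : PartialModule A →ₗ[R] PartialModule A ⊗[R] PartialModule A :=
  lift (map (proj A) (proj A) ∘ₗ comulLift R C) fun t ht =>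
    hA.good (x := Sum.inr t) ht.1 ht.2.1

lemma comul_comp_proj : hA.comul ∘ₗ proj A =
    map (proj A) (proj A) ∘ₗ comulLift R C ∘ₗ restr A := rfl

lemma comul_proj_gen {c : C} (hc : Sum.inl c ∈ A) :
    hA.comul (proj A (gen R c)) =
      map (proj A) (proj A) (comulLift R C (gen R c)) := by
  rw [comul, lift_proj, restr_gen_of_mem hc, LinearMap.comp_apply]

variable (A) in
/-- The counit on the module presented by a set of generators and relations. -/
noncomputable def _root_.PartialPresentation.counit : PartialModule A →ₗ[R] R :=
  Coalgebra.counit ∘ₗ toModule A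

lemma _root_.PartialPresentation.counit_comp_proj :
    counit A ∘ₗ proj A = counitLift R C ∘ₗ restr A := rfl

include hA in
lemma map_restr_comulLift {c : C} (hc : Sum.inl c ∈ A) :
    map (restr A) (restr A) (comulLift R C (gen R c)) =
        comulLift R C (gen R c) := (hA.good hc).1

/-- The coalgebra structure on the module presented by an admissible set. -/
@[reducible]
noncomputable def coalgebra : Coalgebra R (PartialModule A) where
  comul := hA.comul
  counit := counit A
  coassoc := hom_ext fun c hc => by
    -- The formula for `hA.comul ∘ₗ proj A` ends in `restr A`; replacing z by its own restriction
    -- absorbs this.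
    have h1 (z : (FreeOn R C) ⊗[R] (FreeOn R C)) (hz : map (restr A) (restr A) z = z) :
        hA.comul.rTensor _ (map (proj A) (proj A) z) =
          map (map (proj A) (proj A)) (proj A) ((comulLift R C).rTensor _ z) := by
      rw [← hz, LinearMap.rTensor, LinearMap.rTensor]
      simp only [TensorProduct.map_map, comul_comp_proj, LinearMap.id_comp, proj_comp_restr]
    have h2 (z : (FreeOn R C) ⊗[R] (FreeOn R C)) (hz : map (restr A) (restr A) z = z) :
        hA.comul.lTensor _ (map (proj A) (proj A) z) =
          map (proj A) (map (proj A) (proj A)) ((comulLift R C).lTensor _ z) := by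
      rw [← hz, LinearMap.lTensor, LinearMap.lTensor]
      simp only [TensorProduct.map_map, comul_comp_proj, LinearMap.id_comp, proj_comp_restr]
    have h := (hA.good hc).2.1
    have hz := hA.map_restr_comulLift hc
    simp only [LinearMap.comp_apply, LinearEquiv.coe_coe, comul_proj_gen hA hc, h1 _ hz,
      h2 _ hz]
    simpa only [coassocDefect, LinearMap.sub_apply, LinearMap.comp_apply, map_sub,
      LinearEquiv.coe_coe, TensorProduct.map_map_assoc, sub_eq_zero] using h
  rTensor_counit_comp_comul := hom_ext fun c hc => by
    have h1 (z : (FreeOn R C) ⊗[R] (FreeOn R C)) (hz : map (restr A) (restr A) z = z) :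
        (counit A).rTensor _ (map (proj A) (proj A) z) =
          map LinearMap.id (proj A) ((counitLift R C).rTensor _ z) := by
      rw [← hz, LinearMap.rTensor, LinearMap.rTensor]
      simp only [TensorProduct.map_map, counit_comp_proj, LinearMap.id_comp, proj_comp_restr]
    have h := (hA.good hc).2.2.1
    rw [LinearMap.comp_apply, comul_proj_gen hA hc, h1 _ (hA.map_restr_comulLift hc)]
    simpa only [leftCounitDefect, LinearMap.sub_apply, LinearMap.comp_apply, map_sub,
      TensorProduct.mk_apply, TensorProduct.map_tmul, LinearMap.id_apply, sub_eq_zero] using h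
  lTensor_counit_comp_comul := hom_ext fun c hc => by
    have h1 (z : (FreeOn R C) ⊗[R] (FreeOn R C)) (hz : map (restr A) (restr A) z = z) :
        (counit A).lTensor _ (map (proj A) (proj A) z) =
          map (proj A) LinearMap.id ((counitLift R C).lTensor _ z) := by
      rw [← hz, LinearMap.lTensor, LinearMap.lTensor]
      simp only [TensorProduct.map_map, counit_comp_proj, LinearMap.id_comp, proj_comp_restr]
    have h := (hA.good hc).2.2.2.1
    rw [LinearMap.comp_apply, comul_proj_gen hA hc, h1 _ (hA.map_restr_comulLift hc)]
    simpa only [rightCounitDefect, LinearMap.sub_apply, LinearMap.comp_apply, map_sub,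
      TensorProduct.mk_apply, LinearMap.flip_apply, TensorProduct.map_tmul, LinearMap.id_apply,
      sub_eq_zero] using h

lemma isCocomm [hC : Coalgebra.IsCocomm R C] :
    let := hA.coalgebra
    Coalgebra.IsCocomm R (PartialModule A) := by
  let := hA.coalgebra
  refine ⟨hom_ext fun c hc => ?_⟩
  have h := (hA.good hc).2.2.2.2 hC
  change TensorProduct.comm R _ _ (hA.comul _) = hA.comul _
  rw [comul_proj_gen hA hc]
  simpa only [commDefect, LinearMap.sub_apply, LinearMap.comp_apply, map_sub, LinearEquiv.coe_coe,
    TensorProduct.map_comm, sub_eq_zero] using h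

/-- The canonical morphism to `C` from the coalgebra presented by an admissible set. -/
noncomputable def toCoalgebra :
    letI := hA.coalgebra
    PartialModule A →ₗc[R] C :=
  letI := hA.coalgebra
  { toModule A with
    counit_comp := rfl
    map_comp_comul := hom_ext fun c hc => by
      change map (toModule A) (toModule A) (hA.comul _) = Coalgebra.comul (toModule A _)
      rw [comul_proj_gen hA hc, TensorProduct.map_map, toModule_comp_proj,
        TensorProduct.map_comp, LinearMap.comp_apply, hA.map_restr_comulLift hc,
        map_total_comulLift, total_gen, toModule_proj_gen hc] }

/-- The transition morphism between the coalgebras presented by admissible sets. -/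
noncomputable def transitionCoalgHom (h : A ⊆ B) :
    letI := hA.coalgebra
    letI := hB.coalgebra
    PartialModule A →ₗc[R] PartialModule B :=
  letI := hA.coalgebra
  letI := hB.coalgebra
  { transition h with
    counit_comp := LinearMap.ext fun x =>
      congrArg (Coalgebra.counit (R := R)) (toModule_transition h x)
    map_comp_comul := hom_ext fun c hc => by
      change map (transition h) (transition h) (hA.comul _) =
        hB.comul (transition h (proj A (gen R c)))
      rw [comul_proj_gen hA hc, TensorProduct.map_map, transition_comp_proj,
        TensorProduct.map_comp, LinearMap.comp_apply, hA.map_restr_comulLift hc,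
        transition_proj_gen h hc, comul_proj_gen hB (h hc)] }

end IsAdmissible

end PartialPresentation

end

/-! ### Countably presented modules -/

section

open Limits

variable {R : Type u} [CommRing R]

/-- Countable sets are ℵ₁-presentable, and a left adjoint preserves this when its right adjoint,
here the forgetful functor, preserves ℵ₁-filtered colimits. -/
lemma ModuleCat.isCardinalPresentable_free (S : Type u) [Countable S] :
    IsCardinalPresentable ((ModuleCat.free R).obj S) (ℵ₁ : Cardinal.{u}) := by
  have : IsCardinalPresentable S (ℵ₁ : Cardinal.{u}) :=
    HasCardinalLT.isCardinalPresentable (by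
      rw [hasCardinalLT_iff_cardinal_mk_lt, Cardinal.lt_aleph_one_iff, Cardinal.mk_le_aleph0_iff]
      infer_instance)
  have : (forget (ModuleCat.{u} R)).IsCardinalAccessible (ℵ₁ : Cardinal.{u}) :=
    ⟨fun J _ _ => by
      have := isFiltered_of_isCardinalFiltered J (ℵ₁ : Cardinal.{u})
      infer_instance⟩
  exact (ModuleCat.adj R).isCardinalPresentable_leftAdjoint_obj (ℵ₁ : Cardinal.{u}) S

/-- M is the cokernel of a map between free modules on countable sets, and finite colimits of
ℵ₁-presentable objects are ℵ₁-presentable. -/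
lemma ModuleCat.isCardinalPresentable_of_surjective {S : Type u} [Countable S] {M : Type u}
    [AddCommGroup M] [Module R M] (g : (S →₀ R) →ₗ[R] M) (hg : Function.Surjective g)
    (T : Set (S →₀ R)) (hT : T.Countable) (hgT : LinearMap.ker g = Submodule.span R T) :
    IsCardinalPresentable (ModuleCat.of R M) (ℵ₁ : Cardinal.{u}) := by
  have := hT.to_subtype
  let f : (ModuleCat.free R).obj T ⟶ (ModuleCat.free R).obj S :=
    ModuleCat.ofHom (Finsupp.linearCombination R (Subtype.val : T → S →₀ R))
  let g' : (ModuleCat.free R).obj S ⟶ ModuleCat.of R M := ModuleCat.ofHom g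
  have hex : Function.Exact f.hom g'.hom := by
    have h : Submodule.span R T =
        LinearMap.range (Finsupp.linearCombination R (Subtype.val : T → S →₀ R)) := by
      rw [Finsupp.range_linearCombination, Subtype.range_coe]
    exact LinearMap.exact_iff.2 (hgT.trans h)
  have hpair (k : WalkingParallelPair) :
      IsCardinalPresentable ((parallelPair f 0).obj k) (ℵ₁ : Cardinal.{u}) := by
    cases k
    · exact isCardinalPresentable_free T
    · exact isCardinalPresentable_free S
  exact isCardinalPresentable_of_isColimit' _
    (ModuleCat.isColimitCokernelCofork f g' hex hg) (ℵ₁ : Cardinal.{u})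
    (hasCardinalLT_of_finite _ _ Cardinal.isRegular_aleph_one.aleph0_le)

end

/-! ### Colimits of coalgebras, and presentability from the underlying module -/

section

open Limits MonoidalCategory

variable (R : Type u) [CommRing R]

namespace CoalgCat

/-- The forgetful functor from coalgebras to modules as the forgetful functor from comonoids. -/
noncomputable def forgetIso : forget₂ (CoalgCat.{u} R) (ModuleCat.{u} R) ≅
    (comonEquivalence R).functor ⋙ (Comon.Comon_EquivMon_OpOp (ModuleCat.{u} R)).functor ⋙
      (Mon.forget (ModuleCat.{u} R)ᵒᵖ).leftOp :=
  Iso.refl _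

/-- Coalgebras are, up to passing to opposites, monoids in the opposite of the category of modules,
so their colimits come from limits of monoids. -/
instance : HasColimitsOfSize.{u, u} (CoalgCat.{u} R) :=
  have : HasLimitsOfSize.{u, u} (Mon (ModuleCat.{u} R)ᵒᵖ) := ⟨fun _ _ => inferInstance⟩
  have : HasColimitsOfSize.{u, u} (Mon (ModuleCat.{u} R)ᵒᵖ)ᵒᵖ := hasColimits_op_of_hasLimits
  Adjunction.has_colimits_of_equivalence
    ((comonEquivalence R).trans (Comon.Comon_EquivMon_OpOp (ModuleCat.{u} R))).functor

instance : PreservesColimitsOfSize.{u, u} (forget₂ (CoalgCat.{u} R) (ModuleCat.{u} R)) :=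
  have : PreservesLimitsOfSize.{u, u} (Mon.forget (ModuleCat.{u} R)ᵒᵖ) := ⟨inferInstance⟩
  have : PreservesColimitsOfSize.{u, u} (Mon.forget (ModuleCat.{u} R)ᵒᵖ).leftOp :=
    preservesColimitsOfSize_leftOp _
  preservesColimits_of_natIso (forgetIso R).symm

instance : (forget₂ (CoalgCat.{u} R) (ModuleCat.{u} R)).ReflectsIsomorphisms where
  reflects f _ :=
    have : IsIso ((forget (CoalgCat.{u} R)).map f) :=
      inferInstanceAs (IsIso ((forget (ModuleCat.{u} R)).map
        ((forget₂ (CoalgCat.{u} R) (ModuleCat.{u} R)).map f)))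
    isIso_of_reflects_iso f (forget (CoalgCat.{u} R))

instance : ReflectsColimitsOfSize.{u, u} (forget₂ (CoalgCat.{u} R) (ModuleCat.{u} R)) :=
  reflectsColimits_of_reflectsIsomorphisms

variable {R}

/-- The comultiplication as a morphism of modules. -/
noncomputable def comulHom (X : CoalgCat.{u} R) :
    (forget₂ (CoalgCat.{u} R) (ModuleCat.{u} R)).obj X ⟶
      (forget₂ (CoalgCat.{u} R) (ModuleCat.{u} R)).obj X ⊗
        (forget₂ (CoalgCat.{u} R) (ModuleCat.{u} R)).obj X :=
  ModuleCat.ofHom (Coalgebra.comul (R := R) (A := X))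

/-- The counit as a morphism of modules. -/
noncomputable def counitHom (X : CoalgCat.{u} R) :
    (forget₂ (CoalgCat.{u} R) (ModuleCat.{u} R)).obj X ⟶ ModuleCat.of R R :=
  ModuleCat.ofHom (Coalgebra.counit (R := R) (A := X))

lemma comulHom_naturality {X Y : CoalgCat.{u} R} (f : X ⟶ Y) :
    (forget₂ (CoalgCat.{u} R) (ModuleCat.{u} R)).map f ≫ comulHom Y =
      comulHom X ≫ ((forget₂ (CoalgCat.{u} R) (ModuleCat.{u} R)).map f ⊗ₘ
        (forget₂ (CoalgCat.{u} R) (ModuleCat.{u} R)).map f) :=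
  ModuleCat.hom_ext f.toCoalgHom.map_comp_comul.symm

lemma counitHom_naturality {X Y : CoalgCat.{u} R} (f : X ⟶ Y) :
    (forget₂ (CoalgCat.{u} R) (ModuleCat.{u} R)).map f ≫ counitHom Y = counitHom X :=
  ModuleCat.hom_ext f.toCoalgHom.counit_comp

/-- A morphism of coalgebras from a compatible morphism of modules. -/
def homMk {X Y : CoalgCat.{u} R}
    (g : (forget₂ (CoalgCat.{u} R) (ModuleCat.{u} R)).obj X ⟶
      (forget₂ (CoalgCat.{u} R) (ModuleCat.{u} R)).obj Y)
    (hcomul : g ≫ comulHom Y = comulHom X ≫ (g ⊗ₘ g)) (hcounit : g ≫ counitHom Y = counitHom X) :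
    X ⟶ Y where
  toCoalgHom' :=
    { g.hom with
      counit_comp := congrArg ModuleCat.Hom.hom hcounit
      map_comp_comul := (congrArg ModuleCat.Hom.hom hcomul).symm }

@[simp]
lemma forget₂_map_homMk {X Y : CoalgCat.{u} R}
    (g : (forget₂ (CoalgCat.{u} R) (ModuleCat.{u} R)).obj X ⟶
      (forget₂ (CoalgCat.{u} R) (ModuleCat.{u} R)).obj Y)
    (hcomul : g ≫ comulHom Y = comulHom X ≫ (g ⊗ₘ g)) (hcounit : g ≫ counitHom Y = counitHom X) :
    (forget₂ (CoalgCat.{u} R) (ModuleCat.{u} R)).map (homMk g hcomul hcounit) = g := rfl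

/-- A coalgebra is `κ`-presentable if its underlying module is. -/
lemma isCardinalPresentable_of_forget (κ : Cardinal.{u}) [Fact κ.IsRegular] (D : CoalgCat.{u} R)
    [hD : IsCardinalPresentable ((forget₂ (CoalgCat.{u} R) (ModuleCat.{u} R)).obj D) κ] :
    IsCardinalPresentable D κ where
  preservesColimitOfShape J _ _ := ⟨fun {F} ↦ ⟨fun {c} hc ↦ ⟨by
    have := essentiallySmallSelf J
    have := isFiltered_of_isCardinalFiltered J κ
    have := IsFiltered.isSifted (C := J)
    let U := forget₂ (CoalgCat.{u} R) (ModuleCat.{u} R)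
    have hU : IsColimit (U.mapCocone c) := isColimitOfPreserves U hc
    -- J is filtered, hence sifted, so the tensor square of the colimit is the colimit of the tensor
    -- squares.
    have hUU := hU.tensor hU
    refine Types.FilteredColimit.isColimitOf' _ _ (fun f ↦ ?_) (fun j f₁ f₂ hf ↦ ?_)
    · change D ⟶ c.pt at f
      obtain ⟨i, g, hg⟩ := IsCardinalPresentable.exists_hom_of_isColimit κ hU (U.map f)
      change g ≫ U.map (c.ι.app i) = U.map f at hg
      -- The linear lift g need not respect comultiplication, but the two maps to be compared agree
      -- in the colimit of tensor squares, hence at a later stage k.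
      obtain ⟨k, u, hu⟩ := IsCardinalPresentable.exists_eq_of_isColimit' κ hUU
        (g ≫ comulHom (F.obj i)) (comulHom D ≫ (g ⊗ₘ g)) (by
          change (g ≫ comulHom (F.obj i)) ≫ (U.map (c.ι.app i) ⊗ₘ U.map (c.ι.app i)) =
            (comulHom D ≫ (g ⊗ₘ g)) ≫ (U.map (c.ι.app i) ⊗ₘ U.map (c.ι.app i))
          rw [Category.assoc, Category.assoc, ← comulHom_naturality, tensorHom_comp_tensorHom, hg,
            ← comulHom_naturality, reassoc_of% hg]
          rfl)
      change (g ≫ comulHom (F.obj i)) ≫ (U.map (F.map u) ⊗ₘ U.map (F.map u)) =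
        (comulHom D ≫ (g ⊗ₘ g)) ≫ (U.map (F.map u) ⊗ₘ U.map (F.map u)) at hu
      rw [Category.assoc, Category.assoc, ← comulHom_naturality, tensorHom_comp_tensorHom] at hu
      refine ⟨k, homMk (g ≫ U.map (F.map u)) ?_ ?_, U.map_injective ?_⟩
      · rw [Category.assoc, hu]
      -- The counit needs no further stage: the counit of `F.obj i` factors through that of the
      -- colimit.
      · rw [Category.assoc, counitHom_naturality, ← counitHom_naturality (c.ι.app i),
          reassoc_of% hg]
        exact counitHom_naturality f
      · change U.map f = U.map (homMk (g ≫ U.map (F.map u)) _ _ ≫ c.ι.app k)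
        rw [U.map_comp, forget₂_map_homMk, Category.assoc, ← U.map_comp, c.w, hg]
    · change D ⟶ F.obj j at f₁ f₂
      obtain ⟨k, u, hj⟩ := IsCardinalPresentable.exists_eq_of_isColimit' κ hU (U.map f₁) (U.map f₂)
        (congrArg U.map hf)
      exact ⟨k, u, U.map_injective hj⟩⟩⟩⟩

end CoalgCat

end

/-! ### Generators of both categories -/

section

open Limits TensorProduct PartialPresentation

/-- Homs out of X in a full subcategory are homs out of `X.obj` after the inclusion, a composite of
accessible functors. -/
lemma CategoryTheory.ObjectProperty.isCardinalPresentable_of_ι {C : Type*} [Category* C]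
    (P : ObjectProperty C) (κ : Cardinal.{u}) [Fact κ.IsRegular] [P.ι.IsCardinalAccessible κ]
    (X : P.FullSubcategory) [IsCardinalPresentable X.obj κ] : IsCardinalPresentable X κ :=
  Functor.isCardinalAccessible_of_natIso (F := P.ι ⋙ coyoneda.obj (.op X.obj))
    (G := coyoneda.obj (.op X))
    (NatIso.ofComponents (fun Y => (P.fullyFaithfulι.homEquiv (X := X) (Y := Y)).symm.toIso)
      (fun f => by ext g; apply P.ι.map_injective; rfl)) κ

variable (R : Type u) [CommRing R]

/-- The coalgebras whose underlying module is countably presentable and countably generated. -/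
def countableCoalg : ObjectProperty (CoalgCat.{u} R) := fun D =>
  IsCardinalPresentable ((forget₂ (CoalgCat.{u} R) (ModuleCat.{u} R)).obj D) (ℵ₁ : Cardinal.{u}) ∧
    ∃ f : ℕ → D, Function.Surjective (Finsupp.linearCombination R f)

/-- A module structure constant for a coalgebra: a quotient of `ℕ →₀ R` with maps that may be a
comultiplication and a counit. -/
abbrev CoalgCode : Type u :=
  Σ N : Submodule R (ℕ →₀ R), (((ℕ →₀ R) ⧸ N) →ₗ[R] ((ℕ →₀ R) ⧸ N) ⊗[R] ((ℕ →₀ R) ⧸ N)) ×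
    (((ℕ →₀ R) ⧸ N) →ₗ[R] R)

variable {R}

/-- The coalgebra `D` is isomorphic to the one described by the code `t`. -/
def CoalgCode.Describes (t : CoalgCode R) (D : CoalgCat.{u} R) : Prop :=
  ∃ e : ((ℕ →₀ R) ⧸ t.1) ≃ₗ[R] D,
    map e.toLinearMap e.toLinearMap ∘ₗ t.2.1 = Coalgebra.comul ∘ₗ e.toLinearMap ∧
      Coalgebra.counit ∘ₗ e.toLinearMap = t.2.2

lemma CoalgCode.exists_describes {D : CoalgCat.{u} R} {f : ℕ → D}
    (hf : Function.Surjective (Finsupp.linearCombination R f)) :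
    ∃ t : CoalgCode R, t.Describes D := by
  let e := (Finsupp.linearCombination R f).quotKerEquivOfSurjective hf
  refine ⟨⟨_, map e.symm.toLinearMap e.symm.toLinearMap ∘ₗ Coalgebra.comul ∘ₗ e.toLinearMap,
    Coalgebra.counit ∘ₗ e.toLinearMap⟩, e, ?_, rfl⟩
  ext x
  simp [TensorProduct.map_map]

lemma CoalgCode.nonempty_iso {t : CoalgCode R} {D D' : CoalgCat.{u} R} (h : t.Describes D)
    (h' : t.Describes D') : Nonempty (D ≅ D') := by
  obtain ⟨e, h1, h2⟩ := h
  obtain ⟨e', h1', h2'⟩ := h'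
  let φ : D ≃ₗc[R] D' :=
    { e.symm.trans e' with
      counit_comp := LinearMap.ext fun x => by
        have h3 := LinearMap.congr_fun (h2'.trans h2.symm) (e.symm x)
        simpa using h3
      map_comp_comul := LinearMap.ext fun x => by
        obtain ⟨y, rfl⟩ := e.surjective x
        have h3 := LinearMap.congr_fun h1 y
        have h3' := LinearMap.congr_fun h1' y
        simp only [LinearMap.comp_apply, LinearEquiv.coe_coe] at h3 h3'
        change map (e.symm.trans e').toLinearMap (e.symm.trans e').toLinearMap
          (Coalgebra.comul (e y)) = Coalgebra.comul (e' (e.symm (e y)))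
        rw [← h3, e.symm_apply_apply, ← h3', TensorProduct.map_map]
        congr 2 <;> ext <;> simp }
  exact ⟨φ.toCoalgIso⟩

/-- Countable generation bounds the size: each such coalgebra lives, up to isomorphism, on a
quotient of `ℕ →₀ R`, and the codes form a type in `u`. -/
instance : ObjectProperty.EssentiallySmall.{u} (countableCoalg R) where
  exists_small_le' := by
    let g (t : {t : CoalgCode R // ∃ D, t.Describes D}) : CoalgCat.{u} R := t.2.choose
    refine ⟨.ofObj g, inferInstance, fun D ⟨_, f, hf⟩ => ?_⟩
    obtain ⟨t, ht⟩ := CoalgCode.exists_describes hf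
    obtain ⟨e⟩ := CoalgCode.nonempty_iso ht (⟨D, ht⟩ : ∃ D, t.Describes D).choose_spec
    exact ⟨g ⟨t, D, ht⟩, ObjectProperty.ofObj_apply _ _, ⟨e⟩⟩

lemma exists_surjective_linearCombination_nat {S M : Type*} [Countable S] [AddCommGroup M]
    [Module R M] (g : (S →₀ R) →ₗ[R] M) (hg : Function.Surjective g) :
    ∃ f : ℕ → M, Function.Surjective (Finsupp.linearCombination R f) := by
  -- Adjoining 0 makes the set nonempty even for empty S, so that a sequence can enumerate it.
  obtain ⟨f, hf⟩ := ((Set.countable_range fun c => g (Finsupp.single c 1)).insert 0).exists_eq_range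
    (Set.insert_nonempty _ _)
  refine ⟨f, LinearMap.range_eq_top.1 (top_le_iff.1 ?_)⟩
  rw [Finsupp.range_linearCombination, ← hf, ← LinearMap.range_eq_top.2 hg]
  rintro _ ⟨x, rfl⟩
  induction x using Finsupp.induction_linear with
  | zero => simp
  | add x y hx hy => rw [map_add]; exact add_mem hx hy
  | single c r =>
    rw [← mul_one r, ← smul_eq_mul, ← Finsupp.smul_single, map_smul]
    exact Submodule.smul_mem _ r (Submodule.subset_span (Set.mem_insert_of_mem _ ⟨c, rfl⟩))

variable (C : CoalgCat.{u} R)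

/-- The countable admissible sets of generators and relations for a coalgebra. -/
def CountableAdmissible : Type u := {A : Set (Index R C) // A.Countable ∧ IsAdmissible A}

namespace CountableAdmissible

instance : PartialOrder (CountableAdmissible C) := Subtype.partialOrder _

variable {C}

lemma exists_superset {A : Set (Index R C)} (hA : A.Countable) :
    ∃ B : CountableAdmissible C, A ⊆ B.1 := by
  obtain ⟨B, hAB, h⟩ := exists_countable_closed_superset bound hA
  exact ⟨⟨B, h⟩, hAB⟩

lemma exists_le_mem (A : CountableAdmissible C) (x : Index R C) :
    ∃ B : CountableAdmissible C, A ≤ B ∧ x ∈ B.1 := by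
  obtain ⟨B, hB⟩ := exists_superset (A.2.1.insert x)
  exact ⟨B, (Set.subset_insert x A.1).trans hB, hB (Set.mem_insert x A.1)⟩

/-- Admissibility is a closure condition on single elements, so it passes to unions, and countable
unions of countable sets are countable. -/
instance : IsCardinalFiltered (CountableAdmissible C) (ℵ₁ : Cardinal.{u}) :=
  isCardinalFiltered_preorder _ _ fun K s hK => by
    have : Countable K := by
      rwa [Cardinal.lt_aleph_one_iff, Cardinal.mk_le_aleph0_iff] at hK
    refine ⟨⟨⋃ k, (s k).1, Set.countable_iUnion fun k => (s k).2.1, fun x hx => ?_⟩,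
      fun k => Set.subset_iUnion (fun k => (s k).1) k⟩
    obtain ⟨k, hk⟩ := Set.mem_iUnion.1 hx
    exact ((s k).2.2 x hk).trans (Set.subset_iUnion (fun k => (s k).1) k)

instance : IsFiltered (CountableAdmissible C) :=
  isFiltered_of_isCardinalFiltered _ (ℵ₁ : Cardinal.{u})

/-- The countably presented coalgebra given by a countable admissible set. -/
noncomputable def coalg (A : CountableAdmissible C) : CoalgCat.{u} R :=
  letI := A.2.2.coalgebra
  CoalgCat.of R (PartialModule A.1)

variable (C) in
/-- The diagram of countably presented coalgebras given by the countable admissible sets. -/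
noncomputable def diagram : CountableAdmissible C ⥤ CoalgCat.{u} R where
  obj A := A.coalg
  map {A B} h := ⟨A.2.2.transitionCoalgHom B.2.2 (leOfHom h)⟩
  map_id _ := CoalgCat.hom_ext _ _ (CoalgHom.ext fun x => transition_refl x)
  map_comp f g := CoalgCat.hom_ext _ _ (CoalgHom.ext fun x =>
    (transition_transition (leOfHom f) (leOfHom g) x).symm)

variable (C) in
/-- The cocone with point `C` on the diagram of countably presented coalgebras. -/
noncomputable def cocone : Cocone (diagram C) where
  pt := C
  ι :=
    { app A := ⟨A.2.2.toCoalgebra⟩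
      naturality _ _ f := CoalgCat.hom_ext _ _ (CoalgHom.ext fun x =>
        toModule_transition (leOfHom f) x) }

variable (C) in
/-- A coalgebra is the colimit of the countably presented coalgebras given by the countable
admissible sets. -/
noncomputable def isColimitCocone : IsColimit (cocone C) := by
  refine isColimitOfReflects (forget₂ (CoalgCat.{u} R) (ModuleCat.{u} R))
    (isColimitOfReflects (forget (ModuleCat.{u} R)) ?_)
  -- On underlying sets: every element of C is a generator in some A, and a difference that dies in
  -- C dies after one more relation is added.
  refine Types.FilteredColimit.isColimitOf' _ _ (fun c => ?_) (fun A x y hxy => ?_)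
  · change C at c
    obtain ⟨A, hA⟩ := exists_superset (Set.countable_singleton (Sum.inl c : Index R C))
    exact ⟨A, proj A.1 (FreeOn.gen R c), (toModule_proj_gen (hA rfl)).symm⟩
  · change PartialModule A.1 at x y
    have h : toModule A.1 (x - y) = 0 := by
      rw [map_sub, sub_eq_zero]
      exact hxy
    obtain ⟨t, ht⟩ := exists_transition_eq_zero h
    obtain ⟨B, hAB, hB⟩ := exists_le_mem A (Sum.inr t)
    refine ⟨B, homOfLE hAB, ?_⟩
    have h' := ht B.1 hAB hB
    rw [map_sub, sub_eq_zero] at h'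
    exact h'

lemma countableCoalg_coalg (A : CountableAdmissible C) : countableCoalg R A.coalg := by
  obtain ⟨g, hg, e, he, hker⟩ := exists_presentation A.1
  have : Countable {c : C | Sum.inl c ∈ A.1} := (A.2.1.preimage Sum.inl_injective).to_subtype
  exact ⟨ModuleCat.isCardinalPresentable_of_surjective g hg _
    ((countable_relations A.2.1).preimage he) hker, exists_surjective_linearCombination_nat g hg⟩

lemma isCocomm_coalg [Coalgebra.IsCocomm R C] (A : CountableAdmissible C) :
    isCocommCoalg R A.coalg := A.2.2.isCocomm

end CountableAdmissible

variable (R) in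
lemma countableCoalg_isCardinalFilteredGenerator :
    (countableCoalg R).IsCardinalFilteredGenerator (ℵ₁ : Cardinal.{u}) where
  le_isCardinalPresentable D hD :=
    have := hD.1
    CoalgCat.isCardinalPresentable_of_forget ℵ₁ D
  exists_colimitsOfShape C := ⟨CountableAdmissible C, inferInstance, inferInstance,
    ⟨{  diag := CountableAdmissible.diagram C
        ι := (CountableAdmissible.cocone C).ι
        isColimit := CountableAdmissible.isColimitCocone C
        prop_diag_obj := fun A => A.countableCoalg_coalg }⟩⟩

/-- Cocommutativity equates two linear maps out of the colimit module, which can be compared on each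
object of the diagram. -/
instance (J : Type u) [SmallCategory J] : (isCocommCoalg R).IsClosedUnderColimitsOfShape J where
  colimitsOfShape_le := by
    rintro X ⟨p⟩
    let U := forget₂ (CoalgCat.{u} R) (ModuleCat.{u} R)
    have hU : IsColimit (U.mapCocone p.cocone) := isColimitOfPreserves U p.isColimit
    refine ⟨ModuleCat.hom_ext_iff.1 (hU.hom_ext (f := ModuleCat.ofHom _) (f' := ModuleCat.ofHom _)
      fun j => ModuleCat.hom_ext (LinearMap.ext fun x => ?_))⟩
    have hj : Coalgebra.IsCocomm R (p.diag.obj j) := p.prop_diag_obj j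
    have h (x : p.diag.obj j) := LinearMap.congr_fun (p.ι.app j).toCoalgHom.map_comp_comul x
    change TensorProduct.comm R X X (Coalgebra.comul ((p.ι.app j).toCoalgHom.toLinearMap x)) =
      Coalgebra.comul ((p.ι.app j).toCoalgHom.toLinearMap x)
    have h' : map (p.ι.app j).toCoalgHom.toLinearMap (p.ι.app j).toCoalgHom.toLinearMap
      (Coalgebra.comul x) = Coalgebra.comul ((p.ι.app j).toCoalgHom.toLinearMap x) := h x
    rw [← h', ← TensorProduct.map_comm, Coalgebra.comm_comul]

variable (R) in
/-- The cocommutative coalgebras whose underlying module is countably presentable and countably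
generated. -/
def countableCocommCoalg : ObjectProperty (CocommCoalgCat R) :=
  (countableCoalg R).inverseImage (isCocommCoalg R).ι

instance : (isCocommCoalg R).ι.IsCardinalAccessible (ℵ₁ : Cardinal.{u}) where
  preservesColimitOfShape _ _ _ := inferInstance

instance : ObjectProperty.EssentiallySmall.{u} (countableCocommCoalg R) where
  exists_small_le' := by
    obtain ⟨Q, _, -, hQ⟩ := ObjectProperty.EssentiallySmall.exists_small_le.{u} (countableCoalg R)
    let g (X : {X : Subtype Q // ∃ D : CocommCoalgCat R, Nonempty (D.obj ≅ X.1)}) :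
        CocommCoalgCat R := X.2.choose
    refine ⟨.ofObj g, inferInstance, fun D hD => ?_⟩
    obtain ⟨X, hX, ⟨e⟩⟩ := hQ _ hD
    have h : ∃ D : CocommCoalgCat R, Nonempty (D.obj ≅ X) := ⟨D, ⟨e⟩⟩
    exact ⟨g ⟨⟨X, hX⟩, h⟩, ObjectProperty.ofObj_apply _ _,
      ⟨ObjectProperty.isoMk _ (e ≪≫ h.choose_spec.some.symm)⟩⟩

variable (R) in
lemma countableCocommCoalg_isCardinalFilteredGenerator :
    (countableCocommCoalg R).IsCardinalFilteredGenerator (ℵ₁ : Cardinal.{u}) where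
  le_isCardinalPresentable D hD :=
    have : IsCardinalPresentable ((forget₂ (CoalgCat.{u} R) (ModuleCat.{u} R)).obj D.obj)
      (ℵ₁ : Cardinal.{u}) := hD.1
    have : IsCardinalPresentable D.obj (ℵ₁ : Cardinal.{u}) :=
      CoalgCat.isCardinalPresentable_of_forget ℵ₁ D.obj
    (isCocommCoalg R).isCardinalPresentable_of_ι ℵ₁ D
  exists_colimitsOfShape C := by
    have : Coalgebra.IsCocomm R C.obj := C.property
    refine ⟨CountableAdmissible C.obj, inferInstance, inferInstance,
    ⟨{  diag := (isCocommCoalg R).lift (CountableAdmissible.diagram C.obj)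
          fun A => A.isCocomm_coalg
        ι := { app A := ObjectProperty.homMk ((CountableAdmissible.cocone C.obj).ι.app A)
               naturality _ _ f := (isCocommCoalg R).ι.map_injective
                ((CountableAdmissible.cocone C.obj).ι.naturality f) }
        isColimit := isColimitOfReflects (isCocommCoalg R).ι
          (CountableAdmissible.isColimitCocone C.obj)
        prop_diag_obj := fun A => A.countableCoalg_coalg }⟩⟩

end

theorem theorem3p2 (R : Type u) [CommRing R] :
    (IsCardinalLocallyPresentable (CoalgCat.{u} R) (ℵ₁ : Cardinal.{u}) ∧
      ∀ C : CoalgCat.{u} R,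
        IsCardinalPresentable C (ℵ₁ : Cardinal.{u}) ↔
          IsCardinalPresentable ((forget₂ (CoalgCat.{u} R) (ModuleCat.{u} R)).obj C)
            (ℵ₁ : Cardinal.{u})) ∧
    (IsCardinalLocallyPresentable (CocommCoalgCat R) (ℵ₁ : Cardinal.{u}) ∧
      ∀ C : CocommCoalgCat R,
        IsCardinalPresentable C (ℵ₁ : Cardinal.{u}) ↔
          IsCardinalPresentable ((forget₂ (CoalgCat.{u} R) (ModuleCat.{u} R)).obj C.obj)
            (ℵ₁ : Cardinal.{u})) := by
  have h₁ := countableCoalg_isCardinalFilteredGenerator R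
  have h₂ := countableCocommCoalg_isCardinalFilteredGenerator R
  refine ⟨⟨?_, fun C => ⟨fun hC => ?_, fun hC => ?_⟩⟩, ?_, fun C => ⟨fun hC => ?_, fun hC => ?_⟩⟩
  · have := h₁.hasCardinalFilteredGenerator
    exact {}
  -- An ℵ₁-presentable object is a retract of an object of the generator, and retracts of countably
  -- presentable modules are countably presentable.
  · rw [← isCardinalPresentable_iff, h₁.isPresentable_eq_retractClosure] at hC
    obtain ⟨D, hD, ⟨r⟩⟩ := hC
    have := hD.1
    exact (r.map (forget₂ (CoalgCat.{u} R) (ModuleCat.{u} R))).isCardinalPresentable ℵ₁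
  · exact CoalgCat.isCardinalPresentable_of_forget ℵ₁ C
  · have := h₂.hasCardinalFilteredGenerator
    exact { toHasColimitsOfSize := ⟨fun J _ => inferInstance⟩ }
  · rw [← isCardinalPresentable_iff, h₂.isPresentable_eq_retractClosure] at hC
    obtain ⟨D, hD, ⟨r⟩⟩ := hC
    have : IsCardinalPresentable (((isCocommCoalg R).ι ⋙
      forget₂ (CoalgCat.{u} R) (ModuleCat.{u} R)).obj D) (ℵ₁ : Cardinal.{u}) := hD.1
    exact (r.map ((isCocommCoalg R).ι ⋙
      forget₂ (CoalgCat.{u} R) (ModuleCat.{u} R))).isCardinalPresentable ℵ₁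
  · have := CoalgCat.isCardinalPresentable_of_forget ℵ₁ C.obj
    exact (isCocommCoalg R).isCardinalPresentable_of_ι ℵ₁ C
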